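/- All linear orders are strict total orders (possibly empty). A subset $A$ of a linear order $L$ is convex if every element of $L\setminus A$ lies either strictly below all elements of $A$ or strictly above all elements of $A$; a convex embedding is a strictly increasing map between linear orders with convex image, and two linear orders are convex-biembeddable if each admits a convex embedding into the other. For a non-empty countable set $S$ of linear orders, call $\chi:\mathbb{Q}\to S$ a dense colouring if for every $s\in S$ and all rationals $x<x'$ there is $y\in\mathbb{Q}$ with $x<y<x'$ and $\chi(y)=s$. The shuffle $\Xi(S)$ is the ordered sum $\sum_{q\in\mathbb{Q}}\chi(q)$, i.e. the set of pairs $(q,a)$ with $q\in\mathbb{Q}$ and $a\in\chi(q)$ ordered lexicographically, for a dense colouring $\chi:\mathbb{Q}\to S$ (up to isomorphism it does not depend on the choice of $\chi$). Theorem. Let $L_+$ and $L_-$ be convex-biembeddable countable linear orders, and suppose that there are countable sets $S_+$ and $S_-$ of linear orders such that $L_+\cong\Xi(S_+)$ and $L_-\cong\Xi(S_-)$. Then $L_+\cong L_-$. -/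

import Mathlib

universe u v w z

namespace CSBShuffle

/-- A convex embedding of linear orders: a strictly increasing map (equivalently, an embedding of
linear orders) whose image is a convex subset of the codomain. -/
def IsConvexEmbedding {L : Type u} {M : Type v} [LinearOrder L] [LinearOrder M] (f : L → M) :
    Prop :=
  StrictMono f ∧ (Set.range f).OrdConnected

/-- Two linear orders are convex-biembeddable if each has a convex embedding into the other. -/
def ConvexBiembeddable (L : Type u) (M : Type v) [LinearOrder L] [LinearOrder M] : Prop :=
  (∃ f : L → M, IsConvexEmbedding f) ∧ ∃ g : M → L, IsConvexEmbedding g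

/-- A colouring `χ` of a linear order is dense if every colour occurs strictly between any two
points `x < x'`. -/
def IsDenseColoring {L : Type u} {C : Type v} [LinearOrder L] (χ : L → C) : Prop :=
  ∀ c : C, ∀ x x' : L, x < x' → ∃ y : L, x < y ∧ y < x' ∧ χ y = c

/-- The ordered sum `∑_{x ∈ L} χ(x)` of linear orders along a linear order `L`: the set of pairs
`(x, y)` with `x ∈ L` and `y ∈ χ(x)`, ordered lexicographically. -/
abbrev OrderedSum (L : Type u) [LinearOrder L] (S : Set LinOrd.{w}) (χ : L → S) : Type (max u w) :=
  Σₗ x : L, ((χ x : LinOrd.{w}) : Type w)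

/-- `L ≅ Ξ(S)`: the linear order `L` is isomorphic to the ordered sum over the rationals of a dense
`S`-colouring of the rationals. -/
def IsShuffleOf (L : Type u) [LinearOrder L] (S : Set LinOrd.{w}) : Prop :=
  ∃ χ : ℚ → S, IsDenseColoring χ ∧ Nonempty (L ≃o OrderedSum ℚ S χ)

end CSBShuffle

/-! A shuffle `K` enters only through being absorbing: it has a convex copy of itself below and
above each of its points (`IsShuffleOf.absorbs`). In any absorbing order, not being separated by a
convex copy of the whole order (`Near`) is an equivalence relation with convex classes, and `Far`
orders the classes.

Suppose absorbing orders `K` and `M` are convex-biembeddable. A convex embedding `K → M` carries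
each class onto a full class (`Absorbs.sameClass`). Any two distinct classes of `M` have a copy of
`M`, hence of `K`, between them, so every class type of `K` occurs in every finite cut of the
classes of `M`, and conversely (`meetsCuts_sameClass`). Countability and back-and-forth then match
the classes by isomorphism type, and the isomorphisms of classes glue. -/

namespace CSBShuffle

open Set

/-! ### Back-and-forth for coloured orders -/

section BackAndForth

variable {α : Type*} {β : Type*} [LinearOrder β]

/-- Every colour of a point of `α`, as measured by `R`, occurs in every cut between finite subsets
of `β`. -/
def MeetsCuts (R : α → β → Prop) : Prop :=
  ∀ (a : α) (lo hi : Finset β), (∀ x ∈ lo, ∀ y ∈ hi, x < y) →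
    ∃ b, R a b ∧ (∀ x ∈ lo, x < b) ∧ ∀ y ∈ hi, b < y

theorem MeetsCuts.of_lt {R : α → β → Prop} (hne : ∀ a, ∃ b, R a b)
    (hlt : ∀ a y, ∃ b, R a b ∧ b < y) (hgt : ∀ a x, ∃ b, R a b ∧ x < b)
    (hmid : ∀ a x y, x < y → ∃ b, R a b ∧ x < b ∧ b < y) : MeetsCuts R := by
  intro a lo hi h
  rcases lo.eq_empty_or_nonempty with rfl | nlo <;> rcases hi.eq_empty_or_nonempty with rfl | nhi
  · obtain ⟨b, hb⟩ := hne a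
    exact ⟨b, hb, by simp, by simp⟩
  · obtain ⟨b, hb, hb'⟩ := hlt a (hi.min' nhi)
    exact ⟨b, hb, by simp, fun y hy => hb'.trans_le (hi.min'_le y hy)⟩
  · obtain ⟨b, hb, hb'⟩ := hgt a (lo.max' nlo)
    exact ⟨b, hb, fun x hx => (lo.le_max' x hx).trans_lt hb', by simp⟩
  · obtain ⟨b, hb, h1, h2⟩ := hmid a _ _ (h _ (lo.max'_mem nlo) _ (hi.min'_mem nhi))
    exact ⟨b, hb, fun x hx => (lo.le_max' x hx).trans_lt h1,
      fun y hy => h2.trans_le (hi.min'_le y hy)⟩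

variable [LinearOrder α]

/-- A finite set of pairs of `R`-related points whose coordinates are ordered alike. -/
def IsMatching (R : α → β → Prop) (f : Finset (α × β)) : Prop :=
  ∀ p ∈ f, R p.1 p.2 ∧ ∀ q ∈ f, (p.1 < q.1 ↔ p.2 < q.2)

theorem IsMatching.exists_insert_left {R : α → β → Prop} (hR : MeetsCuts R)
    {f : Finset (α × β)} (hf : IsMatching R f) (a : α) : ∃ b, IsMatching R (insert (a, b) f) := by
  classical
  by_cases h : ∃ b, (a, b) ∈ f
  · obtain ⟨b, hb⟩ := h
    exact ⟨b, by rwa [Finset.insert_eq_of_mem hb]⟩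
  push Not at h
  obtain ⟨b, hab, hlo, hhi⟩ := hR a ({p ∈ f | p.1 < a}.image Prod.snd)
    ({p ∈ f | a < p.1}.image Prod.snd) (by
      simp only [Finset.mem_image, Finset.mem_filter]
      rintro _ ⟨p, ⟨hp, hpa⟩, rfl⟩ _ ⟨q, ⟨hq, haq⟩, rfl⟩
      exact ((hf p hp).2 q hq).1 (hpa.trans haq))
  have hlo' : ∀ p ∈ f, p.1 < a → p.2 < b := fun p hp hpa =>
    hlo _ (Finset.mem_image_of_mem _ (Finset.mem_filter.2 ⟨hp, hpa⟩))
  have hhi' : ∀ p ∈ f, a < p.1 → b < p.2 := fun p hp hpa =>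
    hhi _ (Finset.mem_image_of_mem _ (Finset.mem_filter.2 ⟨hp, hpa⟩))
  have hne : ∀ p ∈ f, p.1 < a ∨ a < p.1 := fun p hp =>
    lt_or_gt_of_ne fun he => h p.2 (he ▸ hp)
  have h1 : ∀ p ∈ f, (p.1 < a ↔ p.2 < b) := fun p hp =>
    ⟨hlo' p hp, fun hb => (hne p hp).resolve_right fun hc => hb.asymm (hhi' p hp hc)⟩
  have h2 : ∀ p ∈ f, (a < p.1 ↔ b < p.2) := fun p hp =>
    ⟨hhi' p hp, fun hb => (hne p hp).resolve_left fun hc => hb.asymm (hlo' p hp hc)⟩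
  refine ⟨b, fun p hp => ?_⟩
  rw [Finset.mem_insert] at hp
  rcases hp with rfl | hp
  · refine ⟨hab, fun q hq => ?_⟩
    rw [Finset.mem_insert] at hq
    rcases hq with rfl | hq
    · simp
    · exact h2 q hq
  · refine ⟨(hf p hp).1, fun q hq => ?_⟩
    rw [Finset.mem_insert] at hq
    rcases hq with rfl | hq
    · exact h1 p hp
    · exact (hf p hp).2 q hq

theorem IsMatching.image_swap {R : α → β → Prop} {f : Finset (α × β)} (hf : IsMatching R f) :
    IsMatching (flip R) (f.image Prod.swap) := by
  intro p hp
  obtain ⟨p', hp', rfl⟩ := Finset.mem_image.1 hp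
  refine ⟨(hf p' hp').1, fun q hq => ?_⟩
  obtain ⟨q', hq', rfl⟩ := Finset.mem_image.1 hq
  exact ((hf p' hp').2 q' hq').symm

theorem IsMatching.exists_insert_right {R : α → β → Prop} (hR : MeetsCuts (flip R))
    {f : Finset (α × β)} (hf : IsMatching R f) (b : β) : ∃ a, IsMatching R (insert (a, b) f) := by
  obtain ⟨a, ha⟩ := hf.image_swap.exists_insert_left hR b
  refine ⟨a, ?_⟩
  have := ha.image_swap
  rwa [Finset.image_insert, Finset.image_image, Prod.swap_swap_eq, Finset.image_id] at this

/-- Cantor's back-and-forth theorem for coloured countable dense orders. -/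
theorem exists_orderIso_of_meetsCuts [Countable α] [Countable β] {R : α → β → Prop}
    (h : MeetsCuts R) (h' : MeetsCuts (flip R)) : ∃ e : α ≃o β, ∀ a, R a (e a) := by
  classical
  cases nonempty_encodable α
  cases nonempty_encodable β
  -- The matchings that involve a given point, of either order, are cofinal; an ideal meeting all of
  -- these countably many sets is the graph of the isomorphism.
  let D : α ⊕ β → Order.Cofinal {f : Finset (α × β) // IsMatching R f} := fun s => Sum.recOn s
    (fun a => ⟨{f | ∃ b, (a, b) ∈ f.1}, fun f => by
      obtain ⟨b, hb⟩ := f.2.exists_insert_left h a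
      exact ⟨⟨_, hb⟩, ⟨b, Finset.mem_insert_self _ _⟩, Finset.subset_insert _ _⟩⟩)
    (fun b => ⟨{f | ∃ a, (a, b) ∈ f.1}, fun f => by
      obtain ⟨a, ha⟩ := f.2.exists_insert_right h' b
      exact ⟨⟨_, ha⟩, ⟨a, Finset.mem_insert_self _ _⟩, Finset.subset_insert _ _⟩⟩)
  let I := Order.idealOfCofinals ⟨∅, fun p hp => absurd hp (Finset.notMem_empty p)⟩ D
  have hF : ∀ a, ∃ b, ∃ f ∈ I, (a, b) ∈ f.1 := fun a => by
    obtain ⟨f, ⟨b, hb⟩, hf⟩ := Order.cofinal_meets_idealOfCofinals _ D (Sum.inl a)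
    exact ⟨b, f, hf, hb⟩
  have hG : ∀ b, ∃ a, ∃ f ∈ I, (a, b) ∈ f.1 := fun b => by
    obtain ⟨f, ⟨a, ha⟩, hf⟩ := Order.cofinal_meets_idealOfCofinals _ D (Sum.inr b)
    exact ⟨a, f, hf, ha⟩
  have hlt : ∀ a b a' b', (∃ f ∈ I, (a, b) ∈ f.1) → (∃ f ∈ I, (a', b') ∈ f.1) →
      (a < a' ↔ b < b') := by
    rintro a b a' b' ⟨f, hf, hab⟩ ⟨f', hf', hab'⟩
    obtain ⟨m, -, hm, hm'⟩ := I.directed _ hf _ hf'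
    exact (m.2 _ (hm hab)).2 _ (hm' hab')
  choose F hF using hF
  have hmono : StrictMono F := fun a a' haa => (hlt _ _ _ _ (hF a) (hF a')).1 haa
  have hsurj : Function.Surjective F := fun b => by
    obtain ⟨a, ha⟩ := hG b
    refine ⟨a, le_antisymm (not_lt.1 fun hb => ?_) (not_lt.1 fun hb => ?_)⟩
    · exact lt_irrefl a ((hlt _ _ _ _ ha (hF a)).2 hb)
    · exact lt_irrefl a ((hlt _ _ _ _ (hF a) ha).2 hb)
  refine ⟨hmono.orderIsoOfSurjective F hsurj, fun a => ?_⟩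
  obtain ⟨f, -, hf⟩ := hF a
  exact (f.2 _ hf).1

end BackAndForth

/-! ### Convex embeddings and absorbing orders -/

section ConvexEmbedding

variable {K : Type*} {M : Type*} {N : Type*} [LinearOrder K] [LinearOrder M] [LinearOrder N]

theorem IsConvexEmbedding.comp {g : M → N} {f : K → M} (hg : IsConvexEmbedding g)
    (hf : IsConvexEmbedding f) : IsConvexEmbedding (g ∘ f) := by
  refine ⟨hg.1.comp hf.1, ⟨?_⟩⟩
  rintro _ ⟨x, rfl⟩ _ ⟨y, rfl⟩ z ⟨hz, hz'⟩
  obtain ⟨w, rfl⟩ := hg.2.out ⟨f x, rfl⟩ ⟨f y, rfl⟩ ⟨hz, hz'⟩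
  obtain ⟨v, rfl⟩ := hf.2.out ⟨x, rfl⟩ ⟨y, rfl⟩ ⟨hg.1.le_iff_le.1 hz, hg.1.le_iff_le.1 hz'⟩
  exact ⟨v, rfl⟩

theorem IsConvexEmbedding.of_comp {g : M → N} {f : K → M} (hg : StrictMono g)
    (hgf : IsConvexEmbedding (g ∘ f)) : IsConvexEmbedding f := by
  refine ⟨fun x y hxy => hg.lt_iff_lt.1 (hgf.1 hxy), ⟨?_⟩⟩
  rintro _ ⟨x, rfl⟩ _ ⟨y, rfl⟩ z ⟨hz, hz'⟩
  obtain ⟨v, hv⟩ := hgf.2.out ⟨x, rfl⟩ ⟨y, rfl⟩ ⟨hg.monotone hz, hg.monotone hz'⟩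
  exact ⟨v, hg.injective hv⟩

theorem IsConvexEmbedding.of_orderIso (e : K ≃o M) : IsConvexEmbedding e :=
  ⟨e.strictMono, by rw [e.surjective.range_eq]; exact ordConnected_univ⟩

/-- There is a convex copy of `K` below and above every point of `K`. -/
def Absorbs (K : Type*) [LinearOrder K] : Prop :=
  ∀ z : K, (∃ f : K → K, IsConvexEmbedding f ∧ ∀ x, f x < z) ∧
    ∃ f : K → K, IsConvexEmbedding f ∧ ∀ x, z < f x

theorem Absorbs.of_orderIso (h : Absorbs M) (e : K ≃o M) : Absorbs K := by
  intro z
  obtain ⟨⟨f, hf, hfz⟩, g, hg, hgz⟩ := h (e z)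
  have he := IsConvexEmbedding.of_orderIso e
  have he' := IsConvexEmbedding.of_orderIso e.symm
  exact ⟨⟨_, (he'.comp hf).comp he, fun x => e.symm_apply_lt.2 (hfz _)⟩,
    _, (he'.comp hg).comp he, fun x => e.lt_symm_apply.2 (hgz _)⟩

end ConvexEmbedding

/-! ### Shuffles are absorbing -/

section Shuffle

theorem isConvexEmbedding_sigmaLex {ι : Type*} {κ : Type*} [LinearOrder ι] [LinearOrder κ]
    {A : ι → Type*} {B : κ → Type*} [∀ i, LinearOrder (A i)] [∀ k, LinearOrder (B k)]
    {φ : ι → κ} (hφ : IsConvexEmbedding φ) (e : ∀ i, A i ≃o B (φ i)) :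
    IsConvexEmbedding
      (fun z : Σₗ i, A i => (toLex ⟨φ z.1, e z.1 z.2⟩ : Σₗ k, B k)) := by
  have hfst : ∀ z w : Σₗ k, B k, z ≤ w → z.1 ≤ w.1 := fun z w h => by
    rcases Sigma.Lex.le_def.1 h with h | ⟨h, -⟩
    exacts [h.le, h.le]
  refine ⟨?_, ⟨?_⟩⟩
  · rintro ⟨i, a⟩ ⟨j, b⟩ h
    rcases Sigma.Lex.lt_def.1 h with h | ⟨h, h'⟩
    · exact Sigma.Lex.lt_def.2 (Or.inl (hφ.1 h))
    · obtain rfl : i = j := h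
      exact Sigma.Lex.lt_def.2 (Or.inr ⟨rfl, (e i).strictMono h'⟩)
  · rintro _ ⟨z, rfl⟩ _ ⟨w, rfl⟩ ⟨k, c⟩ ⟨h, h'⟩
    obtain ⟨i, rfl⟩ := hφ.2.out ⟨z.1, rfl⟩ ⟨w.1, rfl⟩ ⟨hfst _ _ h, hfst _ _ h'⟩
    exact ⟨toLex ⟨i, (e i).symm c⟩, by
      change (⟨φ i, e i ((e i).symm c)⟩ : Sigma B) = _
      rw [OrderIso.apply_symm_apply]⟩

/-- The restriction of `χ` to the open-ended interval `I` is again dense with the same colours, so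
back-and-forth gives a colour-preserving isomorphism of `ℚ` with `I`. -/
theorem IsDenseColoring.exists_isConvexEmbedding {C : Type*} {χ : ℚ → C} (hχ : IsDenseColoring χ)
    (I : Set ℚ) [hI : I.OrdConnected] [Nonempty I] [NoMinOrder I] [NoMaxOrder I] :
    ∃ φ : ℚ → ℚ, IsConvexEmbedding φ ∧ (∀ q, φ q ∈ I) ∧ ∀ q, χ q = χ (φ q) := by
  have hmid : ∀ (c : C) (x y : I), x < y → ∃ b : I, χ b = c ∧ x < b ∧ b < y := by
    intro c x y hxy
    obtain ⟨b, h1, h2, h3⟩ := hχ c x y hxy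
    exact ⟨⟨b, hI.out x.2 y.2 ⟨h1.le, h2.le⟩⟩, h3, h1, h2⟩
  have hgt : ∀ (c : C) (x : I), ∃ b : I, χ b = c ∧ x < b := fun c x => by
    obtain ⟨y, hy⟩ := exists_gt x
    obtain ⟨b, h1, h2, -⟩ := hmid c x y hy
    exact ⟨b, h1, h2⟩
  have hlt : ∀ (c : C) (x : I), ∃ b : I, χ b = c ∧ b < x := fun c x => by
    obtain ⟨y, hy⟩ := exists_lt x
    obtain ⟨b, h1, -, h2⟩ := hmid c y x hy
    exact ⟨b, h1, h2⟩
  have h1 : MeetsCuts fun (q : ℚ) (b : I) => χ b = χ q := by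
    refine .of_lt (fun a => ?_) (fun a => hlt _) (fun a => hgt _) (fun a => hmid _)
    obtain ⟨x⟩ := ‹Nonempty I›
    exact (hgt (χ a) x).imp fun _ h => h.1
  have hmid' : ∀ (c : C) (x y : ℚ), x < y → ∃ b, c = χ b ∧ x < b ∧ b < y := fun c x y hxy => by
    obtain ⟨b, h1, h2, h3⟩ := hχ c x y hxy
    exact ⟨b, h3.symm, h1, h2⟩
  have h2 : MeetsCuts (flip fun (q : ℚ) (b : I) => χ b = χ q) := by
    refine .of_lt (fun a => ⟨a, rfl⟩) (fun a y => ?_) (fun a x => ?_) (fun a => hmid' _)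
    · obtain ⟨b, h1, -, h2⟩ := hmid' (χ a) (y - 1) y (by linarith)
      exact ⟨b, h1, h2⟩
    · obtain ⟨b, h1, h2, -⟩ := hmid' (χ a) x (x + 1) (by linarith)
      exact ⟨b, h1, h2⟩
  obtain ⟨e, he⟩ := exists_orderIso_of_meetsCuts h1 h2
  refine ⟨fun q => e q, ?_, fun q => (e q).2, fun q => (he q).symm⟩
  refine IsConvexEmbedding.comp (g := ((↑) : I → ℚ)) ⟨fun _ _ h => h, ?_⟩ (.of_orderIso e)
  rwa [Subtype.range_coe]

theorem IsShuffleOf.absorbs {L : Type*} [LinearOrder L] {S : Set LinOrd} (h : IsShuffleOf L S) :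
    Absorbs L := by
  obtain ⟨χ, hχ, ⟨e⟩⟩ := h
  refine Absorbs.of_orderIso (M := OrderedSum ℚ S χ) ?_ e
  have key : ∀ φ : ℚ → ℚ, IsConvexEmbedding φ → (∀ q, χ q = χ (φ q)) →
      ∃ f : OrderedSum ℚ S χ → OrderedSum ℚ S χ, IsConvexEmbedding f ∧ ∀ x, (f x).1 = φ x.1 := by
    intro φ hφ hχφ
    have heq : ∀ s t : S, s = t →
        Nonempty (((s : LinOrd) : Type _) ≃o ((t : LinOrd) : Type _)) := by
      rintro s _ rfl
      exact ⟨OrderIso.refl _⟩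
    exact ⟨_, isConvexEmbedding_sigmaLex hφ fun q => (heq _ _ (hχφ q)).some, fun x => rfl⟩
  intro z
  constructor
  · obtain ⟨φ, hφ, hI, hc⟩ := hχ.exists_isConvexEmbedding (Iio z.1)
    obtain ⟨f, hf, hf'⟩ := key φ hφ hc
    exact ⟨f, hf, fun x => Sigma.Lex.lt_def.2 (Or.inl ((hf' x).trans_lt (hI _)))⟩
  · obtain ⟨φ, hφ, hI, hc⟩ := hχ.exists_isConvexEmbedding (Ioi z.1)
    obtain ⟨f, hf, hf'⟩ := key φ hφ hc
    exact ⟨f, hf, fun x => Sigma.Lex.lt_def.2 (Or.inl ((hI _).trans_eq (hf' x).symm))⟩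

end Shuffle

/-! ### Near-classes and the isomorphism -/

section Far

variable {K : Type*} {M : Type*} [LinearOrder K] [LinearOrder M]

/-- The interval from `x` to `y` contains a convex copy of the whole order. -/
def Far (x y : K) : Prop :=
  ∃ f : K → K, IsConvexEmbedding f ∧ ∀ k, x ≤ f k ∧ f k ≤ y

/-- Neither of the intervals between `x` and `y` contains a convex copy of the whole order. -/
def Near (x y : K) : Prop :=
  ¬ Far x y ∧ ¬ Far y x

theorem Far.mono {x x' y y' : K} (h : Far x y) (hx : x' ≤ x) (hy : y ≤ y') : Far x' y' := by
  obtain ⟨f, hf, h⟩ := h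
  exact ⟨f, hf, fun k => ⟨hx.trans (h k).1, (h k).2.trans hy⟩⟩

/-- `F` sends the convex copy of `K` below `a` into the interval from `b` to `F a`; precomposing
with `g` makes it a copy of `M`. -/
theorem Absorbs.far_of_forall_le (hK : Absorbs K) {F : K → M} {g : M → K}
    (hF : IsConvexEmbedding F) (hg : IsConvexEmbedding g) {b : M} (hb : ∀ k, b ≤ F k) (a : K) :
    Far b (F a) := by
  obtain ⟨f, hf, h⟩ := (hK a).1
  exact ⟨_, (hF.comp hf).comp hg, fun k => ⟨hb _, hF.1.monotone (h _).le⟩⟩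

theorem Absorbs.far_of_forall_ge (hK : Absorbs K) {F : K → M} {g : M → K}
    (hF : IsConvexEmbedding F) (hg : IsConvexEmbedding g) {b : M} (hb : ∀ k, F k ≤ b) (a : K) :
    Far (F a) b := by
  obtain ⟨f, hf, h⟩ := (hK a).2
  exact ⟨_, (hF.comp hf).comp hg, fun k => ⟨hF.1.monotone (h _).le, hb _⟩⟩

theorem isConvexEmbedding_id : IsConvexEmbedding (id : K → K) :=
  .of_orderIso (OrderIso.refl K)

/-- Compare `y` with a point of the copy lying between `x` and `z`: the part of the copy on either
side of that point contains a further copy. This is what makes `Near` transitive. -/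
theorem Absorbs.far_or_far (hK : Absorbs K) {x z : K} (h : Far x z) (y : K) :
    Far x y ∨ Far y z := by
  obtain ⟨f, hf, h⟩ := h
  -- Any point of the copy would do; `f y` is one at hand.
  rcases le_total (f y) y with hy | hy
  · exact Or.inl
      ((hK.far_of_forall_le hf isConvexEmbedding_id (fun k => (h k).1) y).mono le_rfl hy)
  · exact Or.inr
      ((hK.far_of_forall_ge hf isConvexEmbedding_id (fun k => (h k).2) y).mono hy le_rfl)

theorem Absorbs.lt_of_far (hK : Absorbs K) {x y : K} (h : Far x y) : x < y := by
  obtain ⟨f, hf, h⟩ := h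
  obtain ⟨g, -, hg⟩ := (hK x).2
  exact (h x).1.trans_lt ((hf.1 (hg x)).trans_le (h _).2)

theorem Absorbs.near_refl (hK : Absorbs K) (x : K) : Near x x :=
  ⟨fun h => (hK.lt_of_far h).false, fun h => (hK.lt_of_far h).false⟩

theorem Near.symm {x y : K} (h : Near x y) : Near y x :=
  ⟨h.2, h.1⟩

theorem Absorbs.near_trans (hK : Absorbs K) {x y z : K} (h : Near x y) (h' : Near y z) :
    Near x z :=
  ⟨fun hf => (hK.far_or_far hf y).elim h.1 h'.1, fun hf => (hK.far_or_far hf y).elim h'.2 h.2⟩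

theorem Absorbs.far_congr (hK : Absorbs K) {x x' y y' : K} (h : Far x y) (hx : Near x x')
    (hy : Near y y') : Far x' y' :=
  (hK.far_or_far ((hK.far_or_far h x').resolve_left hx.1) y').resolve_right hy.2

theorem Absorbs.far_of_lt (hK : Absorbs K) {x y : K} (h : x < y) (hn : ¬ Near x y) : Far x y := by
  by_contra hf
  exact hn ⟨hf, fun hf' => (hK.lt_of_far hf').asymm h⟩

theorem Absorbs.exists_transversal (hK : Absorbs K) :
    ∃ r : K → K, (∀ x, Near x (r x)) ∧ ∀ x y, Near x y → r x = r y := by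
  let s : Setoid K := ⟨Near, hK.near_refl, Near.symm, hK.near_trans⟩
  exact ⟨fun x => (⟦x⟧ : Quotient s).out, fun x => Near.symm (Quotient.mk_out (s := s) x),
    fun x y h => congrArg Quotient.out (Quotient.sound (s := s) h)⟩

/-- The `Near`-classes of `a` and `b` are isomorphic. -/
def SameClass (a : K) (b : M) : Prop :=
  Nonempty ({x // Near a x} ≃o {y // Near b y})

theorem SameClass.symm {a : K} {b : M} (h : SameClass a b) : SameClass b a :=
  h.map OrderIso.symm

theorem SameClass.congr_right (hM : Absorbs M) {a : K} {b b' : M} (h : SameClass a b)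
    (hb : Near b b') : SameClass a b' := by
  have : (fun y => Near b y) = fun y => Near b' y :=
    funext fun y => propext ⟨fun h => hM.near_trans hb.symm h, fun h => hM.near_trans hb h⟩
  unfold SameClass at h ⊢
  rwa [← this]

/-- A copy of `M` between `F x` and `F y` lies in the range of `F` by convexity, so it restricts
along `F` and pulls back to a copy of `K`; conversely, copies of `K` become copies of `M` through
`g`. -/
theorem IsConvexEmbedding.far_iff {F : K → M} {g : M → K} (hF : IsConvexEmbedding F)
    (hg : IsConvexEmbedding g) {x y : K} : Far (F x) (F y) ↔ Far x y := by
  constructor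
  · rintro ⟨f, hf, h⟩
    choose f' hf' using fun k => hF.2.out ⟨x, rfl⟩ ⟨y, rfl⟩ (h (F k))
    have hcomp : F ∘ f' = f ∘ F := funext hf'
    refine ⟨f', .of_comp hF.1 (hcomp ▸ hf.comp hF), fun k => ?_⟩
    rw [← hF.1.le_iff_le, ← hF.1.le_iff_le (a := f' k), hf']
    exact h _
  · rintro ⟨f, hf, h⟩
    exact ⟨_, (hF.comp hf).comp hg, fun k => ⟨hF.1.monotone (h _).1, hF.1.monotone (h _).2⟩⟩

/-- The class of `F a` cannot leave the range of `F`: by convexity a point outside the range bounds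
it on one side, and a bound of the range is far from `F a`. -/
theorem Absorbs.sameClass (hK : Absorbs K) {F : K → M} {g : M → K} (hF : IsConvexEmbedding F)
    (hg : IsConvexEmbedding g) (a : K) : SameClass a (F a) := by
  have hnear : ∀ x, Near a x → Near (F a) (F x) := fun x h =>
    ⟨fun h' => h.1 ((hF.far_iff hg).1 h'), fun h' => h.2 ((hF.far_iff hg).1 h')⟩
  let T : {x // Near a x} → {y // Near (F a) y} := fun x => ⟨F x, hnear x x.2⟩
  refine ⟨StrictMono.orderIsoOfSurjective T (fun x y h => hF.1 h) ?_⟩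
  rintro ⟨y, hy⟩
  have hmem : y ∈ range F := by
    by_contra hy'
    have hlow : ∃ k, F k ≤ y := by
      by_contra hc
      push Not at hc
      exact hy.2 (hK.far_of_forall_le hF hg (fun k => (hc k).le) a)
    have hupp : ∃ k, y ≤ F k := by
      by_contra hc
      push Not at hc
      exact hy.1 (hK.far_of_forall_ge hF hg (fun k => (hc k).le) a)
    obtain ⟨k, hk⟩ := hlow
    obtain ⟨l, hl⟩ := hupp
    exact hy' (hF.2.out ⟨k, rfl⟩ ⟨l, rfl⟩ ⟨hk, hl⟩)
  obtain ⟨x, rfl⟩ := hmem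
  exact ⟨⟨x, fun h => hy.1 ((hF.far_iff hg).2 h), fun h => hy.2 ((hF.far_iff hg).2 h)⟩, rfl⟩

theorem lt_iff_far_of_transversal (hK : Absorbs K) {r : K → K} (hr : ∀ x, Near x (r x))
    (hr' : ∀ x y, Near x y → r x = r y) {a b : range r} : a < b ↔ Far (a : K) b := by
  refine ⟨fun h => hK.far_of_lt h fun hn => h.ne ?_, fun h => hK.lt_of_far h⟩
  obtain ⟨⟨_, x, rfl⟩, ⟨_, y, rfl⟩⟩ := a, b
  exact Subtype.ext (hr' x y (hK.near_trans (hr x) (hK.near_trans hn (hr y).symm)))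

/-- For a convex copy `f` of `M` inside the cut, `f (F a)` has the class type of `a` and is far from
the ends of the cut, so its representative under `r` stays strictly inside. -/
theorem meetsCuts_sameClass (hK : Absorbs K) (hM : Absorbs M) {F : K → M} {g : M → K}
    (hF : IsConvexEmbedding F) (hg : IsConvexEmbedding g) {P : Set K} {r : M → M}
    (hr : ∀ x, Near x (r x)) (hr' : ∀ x y, Near x y → r x = r y) :
    MeetsCuts fun (a : P) (b : range r) => SameClass (a : K) (b : M) := by
  have hlt := fun {a b : range r} => lt_iff_far_of_transversal hM hr hr' (a := a) (b := b)
  have hclass : ∀ (f : M → M), IsConvexEmbedding f → ∀ a : P,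
      SameClass (a : K) (r (f (F a)) : M) := fun f hf a =>
    (hK.sameClass (hf.comp hF) hg a).congr_right hM (hr _)
  have hright : ∀ (f : M → M), IsConvexEmbedding f → ∀ (x : range r), (∀ k, (x : M) ≤ f k) →
      ∀ a : P, Far (x : M) (r (f (F a))) := fun f hf x hx a =>
    hM.far_congr (hK.far_of_forall_le (hf.comp hF) hg (fun k => hx _) a) (hM.near_refl _) (hr _)
  have hleft : ∀ (f : M → M), IsConvexEmbedding f → ∀ (y : range r), (∀ k, f k ≤ (y : M)) →
      ∀ a : P, Far (r (f (F a))) (y : M) := fun f hf y hy a =>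
    hM.far_congr (hK.far_of_forall_ge (hf.comp hF) hg (fun k => hy _) a) (hr _) (hM.near_refl _)
  refine .of_lt (fun a => ⟨⟨_, mem_range_self _⟩, hclass id isConvexEmbedding_id a⟩)
    (fun a y => ?_) (fun a x => ?_) (fun a x y hxy => ?_)
  · obtain ⟨f, hf, h⟩ := (hM y).1
    exact ⟨⟨_, mem_range_self _⟩, hclass f hf a, hlt.2 (hleft f hf y (fun k => (h k).le) a)⟩
  · obtain ⟨f, hf, h⟩ := (hM x).2
    exact ⟨⟨_, mem_range_self _⟩, hclass f hf a, hlt.2 (hright f hf x (fun k => (h k).le) a)⟩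
  · obtain ⟨f, hf, h⟩ := hlt.1 hxy
    exact ⟨⟨_, mem_range_self _⟩, hclass f hf a, hlt.2 (hright f hf x (fun k => (h k).1) a),
      hlt.2 (hleft f hf y (fun k => (h k).2) a)⟩

/-- Orders with convex `Near`-classes are glued together from isomorphisms between the classes. -/
theorem nonempty_orderIso_of_transversals (hK : Absorbs K) (hM : Absorbs M) {r : K → K} {s : M → M}
    (hr : ∀ x, Near x (r x)) (hr' : ∀ x y, Near x y → r x = r y)
    (hs : ∀ x, Near x (s x)) (hs' : ∀ x y, Near x y → s x = s y) (φ : range r ≃o range s)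
    (hφ : ∀ a : range r, SameClass (a : K) (φ a : M)) : Nonempty (K ≃o M) := by
  let e := fun a => Nonempty.some (hφ a)
  let ρ : K → range r := fun x => ⟨r x, mem_range_self x⟩
  have hρ : ∀ (a : range r) (x : K), Near (a : K) x → ρ x = a := by
    rintro ⟨_, z, rfl⟩ x h
    exact Subtype.ext (hr' x z (hK.near_trans h.symm (hr z).symm))
  let T : K → M := fun x => e (ρ x) ⟨x, (hr x).symm⟩
  have hT : ∀ (a : range r) (x : K) (h : Near (a : K) x), T x = e a ⟨x, h⟩ := by
    intro a x h
    obtain rfl := hρ a x h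
    rfl
  have hTn : ∀ x, Near (φ (ρ x) : M) (T x) := fun x => (e (ρ x) ⟨x, (hr x).symm⟩).2
  have hmono : StrictMono T := by
    intro x y hxy
    by_cases hn : Near x y
    · have hy : Near (ρ x : K) y := hK.near_trans (hr x).symm hn
      rw [hT (ρ x) x (hr x).symm, hT _ y hy]
      exact (e (ρ x)).strictMono hxy
    · have h1 : ρ x < ρ y := (lt_iff_far_of_transversal hK hr hr').2
        (hK.far_congr (hK.far_of_lt hxy hn) (hr x) (hr y))
      have h2 := (lt_iff_far_of_transversal hM hs hs').1 (φ.strictMono h1)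
      exact hM.lt_of_far (hM.far_congr h2 (hTn x) (hTn y))
  have hsurj : Function.Surjective T := by
    intro y
    obtain ⟨a, ha⟩ := φ.surjective ⟨s y, mem_range_self y⟩
    have hy : Near (φ a : M) y := by
      rw [ha]
      exact (hs y).symm
    refine ⟨(e a).symm ⟨y, hy⟩, ?_⟩
    rw [hT a _ ((e a).symm ⟨y, hy⟩).2]
    simp
  exact ⟨hmono.orderIsoOfSurjective T hsurj⟩

theorem nonempty_orderIso_of_absorbs [Countable K] [Countable M] (h : ConvexBiembeddable K M)
    (hK : Absorbs K) (hM : Absorbs M) : Nonempty (K ≃o M) := by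
  obtain ⟨⟨F, hF⟩, g, hg⟩ := h
  obtain ⟨r, hr, hr'⟩ := hK.exists_transversal
  obtain ⟨s, hs, hs'⟩ := hM.exists_transversal
  have h1 := meetsCuts_sameClass hK hM hF hg (P := range r) hs hs'
  have h2 := meetsCuts_sameClass hM hK hg hF (P := range s) hr hr'
  obtain ⟨φ, hφ⟩ := exists_orderIso_of_meetsCuts h1
    (fun b lo hi h => (h2 b lo hi h).imp fun _ h => ⟨h.1.symm, h.2⟩)
  exact nonempty_orderIso_of_transversals hK hM hr hr' hs hs' φ hφ

end Far

end CSBShuffle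

theorem theorem1 (Lp : Type u) (Lm : Type v) [LinearOrder Lp] [LinearOrder Lm]
    [Countable Lp] [Countable Lm]
    (hconv : CSBShuffle.ConvexBiembeddable Lp Lm)
    (hp : ∃ Sp : Set LinOrd.{w}, Sp.Countable ∧ CSBShuffle.IsShuffleOf Lp Sp)
    (hm : ∃ Sm : Set LinOrd.{z}, Sm.Countable ∧ CSBShuffle.IsShuffleOf Lm Sm) :
    Nonempty (Lp ≃o Lm) := by
  obtain ⟨_, _, hp⟩ := hp
  obtain ⟨_, _, hm⟩ := hm
  exact CSBShuffle.nonempty_orderIso_of_absorbs hconv hp.absorbs hm.absorbs
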